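/- **Setting.** Let $D=\mathbb{R}^d_{\ge 0}$, and order vectors of $\mathbb{R}^d$ componentwise. Let $0=T_0<T_1<\dots<T_N=T$, $N\ge 1$, be equidistant dates, and let $X=(X_t)_{t\in[0,T]}$ be a conservative, time-homogeneous, stochastically continuous Markov process with values in $D$ under a family $(P_x)_{x\in D}$ of probability measures, with $X_0=x$ $P_x$-a.s. Put $$\mathcal{I}_T=\{u\in\mathbb{R}^d : E_x[e^{\langle u,X_T\rangle}]<\infty \text{ for all } x\in D\},$$ write $\mathcal{I}_T^\circ$ for its interior, and assume that $0\in\mathcal{I}_T^\circ$ and that there are functions $\phi:[0,T]\times\mathcal{I}_T\to\mathbb{R}$ and $\psi:[0,T]\times\mathcal{I}_T\to\mathbb{R}^d$ with $$E_x[e^{\langle u,X_t\rangle}]=e^{\phi_t(u)+\langle\psi_t(u),x\rangle}\qquad\text{for all }(t,u,x)\in[0,T]\times\mathcal{I}_T\times D.$$ Let $(X,\mathcal{X},T_N,u,v)$ be a multiple curve affine LIBOR model: under the terminal measure, $X$ starts at $X_0=\mathbf{1}=(1,\dots,1)$, that is, the terminal measure is $P_{\mathbf 1}$; $\mathcal{X}$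 is a finite set of tenors $x$, each with dates $0=T^x_0<\dots<T^x_{N^x}=T_N$ of constant spacing that all belong to $\{T_0,\dots,T_N\}$; $u=(u_1,\dots,u_N)$ lies in $\mathcal{I}_T\cap\mathbb{R}^d_{\ge0}$ and $u_1\ge u_2\ge\dots\ge u_N=0$; and $v=\{(v^x_1,\dots,v^x_{N^x})\}_{x\in\mathcal X}$ lies in $\mathcal{I}_T\cap\mathbb{R}^d_{\ge0}$ with $v^x_k\ge u^x_k$, where $u^x_k=u_l$ if $T^x_k=T_l$. Write $M_0^{w}=E_{\mathbf 1}[e^{\langle w,X_T\rangle}]$, and let the model be fitted to the initial discount factors $B(0,T_1),\dots,B(0,T_N)$, i.e. $M_0^{u_l}=B(0,T_l)/B(0,T_N)$ for $l=1,\dots,N$. An *interpolating function* is a continuous, componentwise decreasing function $\mathcal{U}:[0,T_N]\to\mathcal{I}_T\cap\mathbb{R}^d_{\ge0}$ with bounded right-hand derivatives such that $\mathcal{U}(T_l)=u_l$ for $l=1,\dots,N$. **Proposition 4.10 (existence of a forward-curve-fitting interpolating function).** Let $\tilde f(0,\cdot):[0,T_N]\to\mathbb{R}_{\ge0}$ be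 continuous and consistent with the initial discount factors, i.e. $B(0,T_l)=\exp\big(-\int_0^{T_l}\tilde f(0,s)\,ds\big)$ for $l=1,\dots,N$. Suppose that there is an interpolating function $\hat{\mathcal{U}}$ with $M_0^{\hat{\mathcal U}(0)}=1/B(0,T_N)$ whose image $\mathscr{M}=\hat{\mathcal{U}}([0,T_N])$ is an embedded $C^1$-submanifold of $\mathbb{R}^d$, possibly with boundary, with $\mathscr{M}\subseteq\mathcal{I}_T^\circ\cap\mathbb{R}^d_{\ge0}$. Then there exists a unique continuously differentiable interpolating function $\mathcal{U}:[0,T_N]\to\mathscr{M}$ (with one-sided derivatives at the endpoints) such that $$\phi_{T_N}(\mathcal{U}(\mathcal{T}))+\langle\psi_{T_N}(\mathcal{U}(\mathcal{T})),X_0\rangle=\int_{\mathcal{T}}^{T_N}\tilde f(0,s)\,ds\qquad\text{for all }\mathcal{T}\in[0,T_N].$$ -/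

import Mathlib

open MeasureTheory ProbabilityTheory Set Filter Topology
open scoped NNReal Matrix

namespace AffineLIBOR

/-- The inclusion of the state space `D = ℝ_{≥0}^d` into `ℝ^d`. -/
def toVec {d : ℕ} (x : Fin d → ℝ≥0) : Fin d → ℝ := fun i => (x i : ℝ)

/-- The set of `u ∈ ℝ^d` such that `E_x[exp ⟨u, Y⟩] < ∞` for all `x ∈ D`. -/
def mgfDomain {d : ℕ} {Ω : Type*} [MeasurableSpace Ω] (P : (Fin d → ℝ≥0) → Measure Ω)
    (Y : Ω → Fin d → ℝ≥0) : Set (Fin d → ℝ) :=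
  {u | ∀ x, Integrable (fun ω => Real.exp (u ⬝ᵥ toVec (Y ω))) (P x)}

/-- A conservative, time-homogeneous, stochastically continuous Markov process `(X_t)_{t ∈ [0,T]}`
with state space `D = ℝ_{≥0}^d` under a family `(P_x)_{x ∈ D}` of probability measures, whose moment
generating function at time `T` is finite around `0` and whose moment generating functions are
exponentially affine in the starting point. Times are real numbers, but only times in `[0,T]`
are used; `φ` and `ψ` are only used on `[0,T] × 𝓘_T`, where they are determined by `affine`. -/
structure AffineProcess (d : ℕ) (T : ℝ) (Ω : Type*) [mΩ : MeasurableSpace Ω] where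
  /-- the filtration -/
  F : Filtration ℝ mΩ
  /-- the family of probability measures -/
  P : (Fin d → ℝ≥0) → Measure Ω
  /-- the process -/
  X : ℝ → Ω → Fin d → ℝ≥0
  isProbabilityMeasure : ∀ x, IsProbabilityMeasure (P x)
  adapted : ∀ t ∈ Icc 0 T, Measurable[F t] (X t)
  start : ∀ x, ∀ᵐ ω ∂(P x), X 0 ω = x
  measurable_transition : ∀ t ∈ Icc 0 T, ∀ A : Set (Fin d → ℝ≥0), MeasurableSet A →
    Measurable fun x => P x (X t ⁻¹' A)
  /-- the Markov property `P_x(X_{s+t} ∈ A | F_s) = P_{X_s}(X_t ∈ A)` -/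
  markov : ∀ x, ∀ s t : ℝ, 0 ≤ s → 0 ≤ t → s + t ≤ T →
    ∀ A : Set (Fin d → ℝ≥0), MeasurableSet A →
      (P x)⟦X (s + t) ⁻¹' A | F s⟧ =ᵐ[P x] fun ω => (P (X s ω)).real (X t ⁻¹' A)
  stochasticallyContinuous : ∀ x, ∀ t ∈ Icc 0 T,
    TendstoInMeasure (P x) X (𝓝[Icc 0 T] t) (X t)
  zero_mem_interior : (0 : Fin d → ℝ) ∈ interior (mgfDomain P (X T))
  φ : ℝ → (Fin d → ℝ) → ℝ
  ψ : ℝ → (Fin d → ℝ) → Fin d → ℝ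
  /-- `E_x[exp ⟨u, X_t⟩] = exp (φ_t(u) + ⟨ψ_t(u), x⟩)`. The right-hand side is positive, so this
  includes the finiteness of the expectation. -/
  affine : ∀ t ∈ Icc 0 T, ∀ u ∈ mgfDomain P (X T), ∀ x,
    ∫ ω, Real.exp (u ⬝ᵥ toVec (X t ω)) ∂(P x) = Real.exp (φ t u + ψ t u ⬝ᵥ toVec x)

/-- The set `𝓘_T`. -/
def AffineProcess.I {d : ℕ} {T : ℝ} {Ω : Type*} [MeasurableSpace Ω]
    (Z : AffineProcess d T Ω) : Set (Fin d → ℝ) :=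
  mgfDomain Z.P (Z.X T)

/-- A multiple curve affine LIBOR model `(X, 𝒳, T_N, u, v)`, on the equidistant time structure
`T_k = k δ`, `0 ≤ k ≤ N`. A tenor is recorded by the number `m` of periods `δ` that it contains:
its tenor structure is `T^m_k = k (m δ)`, `0 ≤ k ≤ N / m`, which ends in `T_N`, and `u^m_k = u_{k m}`.
The measure `P_N` is `P_𝟏`, under which `X` starts at `𝟏 = (1, …, 1)`. Only `u_1, …, u_N` are used,
and only `v^m_k` for tenors `m` and `1 ≤ k ≤ N / m`. -/
structure Model (d : ℕ) (Ω : Type*) [MeasurableSpace Ω] where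
  N : ℕ
  N_pos : 0 < N
  δ : ℝ
  δ_pos : 0 < δ
  /-- the set `𝒳` of tenors -/
  tenors : Finset ℕ
  tenors_pos : ∀ m ∈ tenors, 0 < m
  tenors_dvd : ∀ m ∈ tenors, m ∣ N
  /-- the driving affine process, with horizon `T = T_N` -/
  Z : AffineProcess d (N * δ) Ω
  u : ℕ → Fin d → ℝ
  u_mem : ∀ l, 1 ≤ l → l ≤ N → u l ∈ Z.I
  u_nonneg : ∀ l, 1 ≤ l → l ≤ N → 0 ≤ u l
  u_decreasing : ∀ l, 1 ≤ l → l < N → u (l + 1) ≤ u l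
  u_last : u N = 0
  v : ℕ → ℕ → Fin d → ℝ
  v_mem : ∀ m ∈ tenors, ∀ k, 1 ≤ k → k ≤ N / m → v m k ∈ Z.I
  v_nonneg : ∀ m ∈ tenors, ∀ k, 1 ≤ k → k ≤ N / m → 0 ≤ v m k
  u_le_v : ∀ m ∈ tenors, ∀ k, 1 ≤ k → k ≤ N / m → u (k * m) ≤ v m k

namespace Model

variable {d : ℕ} {Ω : Type*} [MeasurableSpace Ω]

/-- The date `T_k`. -/
def time (L : Model d Ω) (k : ℕ) : ℝ := k * L.δ

/-- The terminal date `T_N`. -/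
def TN (L : Model d Ω) : ℝ := L.time L.N

/-- `M_0^w = E_𝟏[exp ⟨w, X_{T_N}⟩]`, the initial value of the martingale `M^w`. -/
noncomputable def M₀ (L : Model d Ω) (w : Fin d → ℝ) : ℝ :=
  ∫ ω, Real.exp (w ⬝ᵥ toVec (L.Z.X L.TN ω)) ∂(L.Z.P 1)

/-- Interpolating functions: continuous, componentwise decreasing functions
`U : [0,T_N] → 𝓘_T ∩ ℝ_{≥0}^d` with bounded right-hand derivatives and `U(T_l) = u_l` for
`1 ≤ l ≤ N`. The values of `U` outside `[0,T_N]` are irrelevant. -/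
structure IsInterpolating (L : Model d Ω) (U : ℝ → Fin d → ℝ) : Prop where
  continuousOn : ContinuousOn U (Icc 0 L.TN)
  antitoneOn : AntitoneOn U (Icc 0 L.TN)
  nonneg : ∀ t ∈ Icc 0 L.TN, 0 ≤ U t
  mem_I : ∀ t ∈ Icc 0 L.TN, U t ∈ L.Z.I
  rightDeriv : ∃ (U' : ℝ → Fin d → ℝ) (C : ℝ), ∀ t ∈ Ico 0 L.TN,
    HasDerivWithinAt U (U' t) (Ioi t) t ∧ ‖U' t‖ ≤ C
  interpolates : ∀ l, 1 ≤ l → l ≤ L.N → U (L.time l) = L.u l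

/-- `U` is a continuously differentiable interpolating function `[0,T_N] → M` such that
`φ_{T_N}(U(t)) + ⟨ψ_{T_N}(U(t)), X_0⟩ = ∫_t^{T_N} f(s) ds` for all `t ∈ [0,T_N]`, where `X_0 = 𝟏`. -/
structure IsFittingInterpolation (L : Model d Ω) (f : ℝ → ℝ) (M : Set (Fin d → ℝ))
    (U : ℝ → Fin d → ℝ) : Prop where
  isInterpolating : L.IsInterpolating U
  contDiffOn : ContDiffOn ℝ 1 U (Icc 0 L.TN)
  mapsTo : MapsTo U (Icc 0 L.TN) M
  fits : ∀ t ∈ Icc 0 L.TN,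
    L.Z.φ L.TN (U t) + L.Z.ψ L.TN (U t) ⬝ᵥ (1 : Fin d → ℝ) = ∫ s in t..L.TN, f s

end Model

/-- The coordinate subspace `ℝ^k × {0}` of `ℝ^d`. -/
def slice (d k : ℕ) : Set (Fin d → ℝ) := {y | ∀ i : Fin d, k ≤ (i : ℕ) → y i = 0}

/-- The half-space of `ℝ^k × {0}` in which the first coordinate is nonnegative. -/
def halfSlice (d k : ℕ) : Set (Fin d → ℝ) :=
  {y | y ∈ slice d k ∧ ∀ i : Fin d, (i : ℕ) = 0 → 0 ≤ y i}

/-- `M` is a `k`-dimensional embedded `C¹`-submanifold of `ℝ^d`, possibly with boundary: around each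
of its points, some `C¹`-diffeomorphism between open subsets of `ℝ^d` maps `M` to
`ℝ^k × {0}` or to a half-space of it. -/
def IsC1Submanifold {d : ℕ} (k : ℕ) (M : Set (Fin d → ℝ)) : Prop :=
  ∀ p ∈ M, ∃ Φ : OpenPartialHomeomorph (Fin d → ℝ) (Fin d → ℝ), p ∈ Φ.source ∧
    ContDiffOn ℝ 1 Φ Φ.source ∧ ContDiffOn ℝ 1 Φ.symm Φ.target ∧
    (Φ.IsImage M (slice d k) ∨ Φ.IsImage M (halfSlice d k))

end AffineLIBOR

namespace AffineLIBOR

/-! By the affine formula, the fitting equation at time t says M_0^{U(t)} = exp ∫_t^{T_N} f. The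
image M of the decreasing curve Û is a chain for the componentwise order, and w ↦ M_0^w is strictly
increasing, hence injective on M (`Model.injOn_M₀`). So U(t) is forced, and it exists by the
intermediate value theorem, because M_0 ∘ Û runs continuously from 1/B(0,T_N) down to 1.

Smoothness of U uses the manifold structure. A continuous injective real function on M leaves no
room for two independent chart directions, so M is locally a point or an arc. The velocity of a
chart curve is a limit of difference quotients of comparable points, so it is ≥ 0 or ≤ 0, and it is
nonzero. The gradient of M_0 is strictly positive on nonzero v ≥ 0, so M_0 has nonzero derivative
along the arc and the inverse function theorem applies
(`IsC1Submanifold.exists_contDiffAt_leftInverse`).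

Strict positivity requires that no coordinate of X_T vanish almost surely
(`AffineProcess.not_ae_eq_zero`). Otherwise the Markov property and the affine formula would make
some coordinate vanish at T/2, T/4, and so on, against stochastic continuity at time 0, where X = 𝟏.
-/

theorem toVec_nonneg {d : ℕ} (x : Fin d → ℝ≥0) : 0 ≤ toVec x := fun i => (x i).2

theorem toVec_one {d : ℕ} : toVec (1 : Fin d → ℝ≥0) = 1 := by
  ext i; simp [toVec]

theorem measurable_toVec {d : ℕ} : Measurable (toVec : (Fin d → ℝ≥0) → Fin d → ℝ) :=
  measurable_pi_lambda _ fun i => (measurable_pi_apply i).coe_nnreal_real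

theorem measurable_dotProduct_toVec {d : ℕ} (u : Fin d → ℝ) :
    Measurable fun x : Fin d → ℝ≥0 => u ⬝ᵥ toVec x :=
  Finset.measurable_sum _ fun i _ =>
    ((measurable_pi_apply i).coe_nnreal_real).const_mul (u i)

theorem dotProduct_toVec_nonpos {d : ℕ} {u : Fin d → ℝ} (hu : u ≤ 0) (x : Fin d → ℝ≥0) :
    u ⬝ᵥ toVec x ≤ 0 :=
  Finset.sum_nonpos fun i _ => mul_nonpos_of_nonpos_of_nonneg (hu i) (toVec_nonneg x i)

/-- An integrand bounded by one whose mean is one is almost surely equal to one. -/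
theorem ae_eq_one_of_integral_eq_one {Ω : Type*} [MeasurableSpace Ω] {μ : Measure Ω}
    [IsProbabilityMeasure μ] {g : Ω → ℝ} (hg : Integrable g μ) (h1 : ∀ ω, g ω ≤ 1)
    (h : ∫ ω, g ω ∂μ = 1) : ∀ᵐ ω ∂μ, g ω = 1 := by
  have h0 : ∫ ω, (1 - g ω) ∂μ = 0 := by
    rw [integral_sub (integrable_const _) hg, h]; simp
  rw [integral_eq_zero_iff_of_nonneg (fun ω => sub_nonneg.2 (h1 ω))
    ((integrable_const _).sub hg)] at h0
  filter_upwards [h0] with ω hω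
  simp only [Pi.zero_apply] at hω
  linarith

/-! ### Nondegeneracy: no coordinate of the affine process vanishes at the horizon. -/

namespace AffineProcess

variable {d : ℕ} {T : ℝ} {Ω : Type*} [MeasurableSpace Ω] (Z : AffineProcess d T Ω)

instance (x : Fin d → ℝ≥0) : IsProbabilityMeasure (Z.P x) := Z.isProbabilityMeasure x

theorem measurable_X {t : ℝ} (ht : t ∈ Icc 0 T) : Measurable (Z.X t) :=
  (Z.adapted t ht).mono (Z.F.le t) le_rfl

theorem measurable_exp {t : ℝ} (ht : t ∈ Icc 0 T) (u : Fin d → ℝ) :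
    Measurable fun ω => Real.exp (u ⬝ᵥ toVec (Z.X t ω)) :=
  Real.measurable_exp.comp ((measurable_dotProduct_toVec u).comp (Z.measurable_X ht))

theorem integrable_exp_of_nonpos {t : ℝ} (ht : t ∈ Icc 0 T) {u : Fin d → ℝ} (hu : u ≤ 0)
    (x : Fin d → ℝ≥0) : Integrable (fun ω => Real.exp (u ⬝ᵥ toVec (Z.X t ω))) (Z.P x) := by
  refine Integrable.of_bound (Z.measurable_exp ht u).aestronglyMeasurable 1 (ae_of_all _ fun ω => ?_)
  rw [Real.norm_of_nonneg (Real.exp_pos _).le]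
  exact Real.exp_le_one_iff.2 (dotProduct_toVec_nonpos hu _)

theorem mem_I_of_nonpos (hT : 0 ≤ T) {u : Fin d → ℝ} (hu : u ≤ 0) : u ∈ Z.I :=
  fun x => Z.integrable_exp_of_nonpos ⟨hT, le_rfl⟩ hu x

theorem exponent_nonpos {t : ℝ} (ht : t ∈ Icc 0 T) {u : Fin d → ℝ} (hu : u ≤ 0)
    (x : Fin d → ℝ≥0) : Z.φ t u + Z.ψ t u ⬝ᵥ toVec x ≤ 0 := by
  rw [← Real.exp_le_one_iff,
    ← Z.affine t ht u (Z.mem_I_of_nonpos (ht.1.trans ht.2) hu) x]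
  calc _ ≤ ∫ _, (1 : ℝ) ∂(Z.P x) :=
        integral_mono (Z.integrable_exp_of_nonpos ht hu x) (integrable_const _)
          fun ω => Real.exp_le_one_iff.2 (dotProduct_toVec_nonpos hu _)
    _ = 1 := by simp

theorem φ_nonpos {t : ℝ} (ht : t ∈ Icc 0 T) {u : Fin d → ℝ} (hu : u ≤ 0) : Z.φ t u ≤ 0 := by
  have h := Z.exponent_nonpos ht hu 0
  have h0 : toVec (0 : Fin d → ℝ≥0) = 0 := by ext i; simp [toVec]
  simpa [h0] using h

theorem ψ_nonpos {t : ℝ} (ht : t ∈ Icc 0 T) {u : Fin d → ℝ} (hu : u ≤ 0) : Z.ψ t u ≤ 0 := by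
  intro i
  by_contra! hi
  simp only [Pi.zero_apply] at hi
  -- Started from n times the i-th unit vector, the exponent is φ + n ψ_i, which is positive for
  -- this n.
  obtain ⟨n, hn⟩ := exists_nat_gt (-Z.φ t u / Z.ψ t u i)
  rw [div_lt_iff₀ hi] at hn
  have h := Z.exponent_nonpos ht hu (Pi.single i (n : ℝ≥0))
  have h0 : toVec (Pi.single i (n : ℝ≥0)) = Pi.single i (n : ℝ) := by
    ext j
    by_cases hj : j = i
    · subst hj; simp [toVec]
    · simp [toVec, hj]
  rw [h0, dotProduct_single] at h
  linarith

/-- The `i`-th coordinate of the process vanishes at time `t`, wherever the process starts. -/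
def Vanishes (t : ℝ) (i : Fin d) : Prop := ∀ x, ∀ᵐ ω ∂(Z.P x), Z.X t ω i = 0

theorem neg_single_nonpos (i : Fin d) : (-Pi.single i 1 : Fin d → ℝ) ≤ 0 :=
  neg_nonpos.2 (Pi.single_nonneg.2 zero_le_one)

/-- The variable exp(-X_t^i) is at most 1, so it equals 1 almost surely exactly when its mean, given
by the affine formula at -e_i, is 1. -/
theorem ae_eq_zero_iff {t : ℝ} (ht : t ∈ Icc 0 T) (i : Fin d) (x : Fin d → ℝ≥0) :
    (∀ᵐ ω ∂(Z.P x), Z.X t ω i = 0) ↔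
      Z.φ t (-Pi.single i 1) + Z.ψ t (-Pi.single i 1) ⬝ᵥ toVec x = 0 := by
  have hu := neg_single_nonpos i
  have hI := Z.affine t ht _ (Z.mem_I_of_nonpos (ht.1.trans ht.2) hu) x
  rw [← Real.exp_eq_one_iff, ← hI]
  have hdot : ∀ ω, (-Pi.single i 1 : Fin d → ℝ) ⬝ᵥ toVec (Z.X t ω) = -(Z.X t ω i : ℝ) := by
    intro ω; simp [toVec]
  constructor
  · intro h
    rw [integral_congr_ae (g := fun _ => (1 : ℝ))]
    · simp
    · filter_upwards [h] with ω hω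
      rw [hdot, hω]; simp
  · intro h
    filter_upwards [ae_eq_one_of_integral_eq_one (Z.integrable_exp_of_nonpos ht hu x)
      (fun ω => Real.exp_le_one_iff.2 (dotProduct_toVec_nonpos hu _)) h] with ω hω
    rw [hdot, Real.exp_eq_one_iff, neg_eq_zero] at hω
    exact_mod_cast hω

/-- The starting point 𝟏 has all coordinates positive, so a zero exponent there, being a sum of
nonpositive terms, forces φ = 0 and ψ = 0 at -e_i. The exponent is then zero for every starting
point. -/
theorem vanishes_of_ae_one {t : ℝ} (ht : t ∈ Icc 0 T) {i : Fin d}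
    (h : ∀ᵐ ω ∂(Z.P 1), Z.X t ω i = 0) : Z.Vanishes t i := by
  have hu := neg_single_nonpos i
  rw [Z.ae_eq_zero_iff ht, toVec_one] at h
  have h1 := Z.φ_nonpos ht hu
  have h2 := Z.ψ_nonpos ht hu
  have h3 : Z.ψ t (-Pi.single i 1) ⬝ᵥ (1 : Fin d → ℝ) ≤ 0 := by
    rw [dotProduct_one]
    exact Finset.sum_nonpos fun j _ => h2 j
  have h4 : Z.ψ t (-Pi.single i 1) = 0 := by
    have h5 : Z.ψ t (-Pi.single i 1) ⬝ᵥ (1 : Fin d → ℝ) = 0 := by linarith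
    rw [dotProduct_one, Finset.sum_eq_zero_iff_of_nonpos fun j _ => h2 j] at h5
    ext j
    exact h5 j (Finset.mem_univ j)
  intro x
  rw [Z.ae_eq_zero_iff ht]
  rw [h4] at h ⊢
  simpa using h

/-- By the Markov property, almost surely P_{X_t}(X_t^i = 0) = 1, that is, φ + ⟨ψ, X_t⟩ = 0 at -e_i.
All terms are nonpositive, so each ψ_j X_t^j is zero, and any j with ψ_j ≠ 0 is a vanishing
coordinate. -/
theorem exists_vanishes_half {t : ℝ} (ht : 0 ≤ t) (htT : t + t ≤ T) {i : Fin d}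
    (h : Z.Vanishes (t + t) i) : ∃ j, Z.Vanishes t j := by
  have htm : t ∈ Icc 0 T := ⟨ht, by linarith⟩
  have hu := neg_single_nonpos i
  have hA : MeasurableSet {y : Fin d → ℝ≥0 | y i = 0} :=
    measurableSet_eq_fun (measurable_pi_apply i) measurable_const
  have hm := Z.markov 1 t t ht ht htT _ hA
  have hone : (Z.P 1)⟦Z.X (t + t) ⁻¹' {y | y i = 0}|Z.F t⟧ =ᵐ[Z.P 1] fun _ => (1 : ℝ) := by
    refine (condExp_congr_ae ?_).trans (condExp_const (μ := Z.P 1) (Z.F.le t) (1 : ℝ)).eventuallyEq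
    filter_upwards [h 1] with ω hω
    exact indicator_of_mem (M := ℝ) (show ω ∈ Z.X (t + t) ⁻¹' {y | y i = 0} from hω) _
  have hae : ∀ᵐ ω ∂(Z.P 1), Z.φ t (-Pi.single i 1) = 0 ∧
      ∀ j, Z.ψ t (-Pi.single i 1) j * Z.X t ω j = 0 := by
    filter_upwards [hm, hone] with ω h1 h2
    rw [h2] at h1
    have h3 : ∀ᵐ ω' ∂(Z.P (Z.X t ω)), Z.X t ω' i = 0 := by
      have h4 : Z.P (Z.X t ω) (Z.X t ⁻¹' {y | y i = 0}) = 1 := by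
        rw [measureReal_def] at h1
        exact (ENNReal.toReal_eq_one_iff _).1 h1.symm
      exact (mem_ae_iff_prob_eq_one (Z.measurable_X htm hA)).2 h4
    rw [Z.ae_eq_zero_iff htm] at h3
    have h5 := Z.φ_nonpos htm hu
    have h6 := dotProduct_toVec_nonpos (Z.ψ_nonpos htm hu) (Z.X t ω)
    refine ⟨by linarith, fun j => ?_⟩
    have h7 : Z.ψ t (-Pi.single i 1) ⬝ᵥ toVec (Z.X t ω) = 0 := by linarith
    exact (Finset.sum_eq_zero_iff_of_nonpos fun j _ => mul_nonpos_of_nonpos_of_nonneg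
      (Z.ψ_nonpos htm hu j) (toVec_nonneg _ j)).1 h7 j (Finset.mem_univ j)
  -- If ψ = 0, the exponent is just φ = 0, so the coordinate i itself already vanishes at time t.
  by_cases hψ : Z.ψ t (-Pi.single i 1) = 0
  · refine ⟨i, Z.vanishes_of_ae_one htm ?_⟩
    rw [Z.ae_eq_zero_iff htm, hψ, zero_dotProduct, add_zero]
    exact hae.exists.choose_spec.1
  · obtain ⟨j, hj⟩ := Function.ne_iff.1 hψ
    refine ⟨j, Z.vanishes_of_ae_one htm ?_⟩
    filter_upwards [hae] with ω hω
    exact_mod_cast (mul_eq_zero.1 (hω.2 j)).resolve_left hj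

theorem not_vanishes (hT : 0 < T) (i : Fin d) : ¬ Z.Vanishes T i := by
  intro hi
  have hex : ∀ n : ℕ, ∃ j, Z.Vanishes (T / 2 ^ n) j := by
    intro n
    induction n with
    | zero => exact ⟨i, by simpa using hi⟩
    | succ n ih =>
      obtain ⟨j, hj⟩ := ih
      have h2 : T / 2 ^ (n + 1) + T / 2 ^ (n + 1) = T / 2 ^ n := by
        rw [pow_succ]; field_simp; norm_num
      refine Z.exists_vanishes_half (by positivity) ?_ (i := j) (by rwa [h2])
      rw [h2]
      exact div_le_self hT.le (one_le_pow₀ (by norm_num))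
  have hlim : Tendsto (fun n : ℕ => T / 2 ^ n) atTop (𝓝[Icc 0 T] 0) := by
    refine tendsto_nhdsWithin_iff.2 ⟨?_, Eventually.of_forall fun n =>
      ⟨by positivity, div_le_self hT.le (one_le_pow₀ (by norm_num))⟩⟩
    simpa [div_eq_mul_inv] using
      (tendsto_pow_atTop_nhds_zero_of_lt_one (r := (2 : ℝ)⁻¹) (by norm_num)
        (by norm_num)).const_mul T
  have hs := ((Z.stochasticallyContinuous 1 0 ⟨le_rfl, hT.le⟩) 1 one_pos).comp hlim
  -- The vanishing coordinate j depends on n, but the sup distance to X_0 = 𝟏 is at least 1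
  -- whichever j it is.
  have hone : ∀ n : ℕ, Z.P 1 {ω | 1 ≤ edist (Z.X (T / 2 ^ n) ω) (Z.X 0 ω)} = 1 := by
    intro n
    obtain ⟨j, hj⟩ := hex n
    refine (measure_congr (eventuallyEq_univ.2 ?_)).trans measure_univ
    filter_upwards [hj 1, Z.start 1] with ω h1 h2
    refine le_trans ?_ (edist_le_pi_edist _ _ j)
    rw [h1, h2, edist_comm]
    simp [edist_dist, NNReal.dist_eq]
  have : Tendsto (fun _ : ℕ => (1 : ENNReal)) atTop (𝓝 0) := hs.congr hone
  exact one_ne_zero (tendsto_nhds_unique tendsto_const_nhds this)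

/-- No coordinate of the process vanishes almost surely at the terminal time. -/
theorem not_ae_eq_zero (hT : 0 < T) (i : Fin d) : ¬ ∀ᵐ ω ∂(Z.P 1), Z.X T ω i = 0 :=
  fun h => Z.not_vanishes hT i (Z.vanishes_of_ae_one ⟨hT.le, le_rfl⟩ h)

end AffineProcess

/-- The linear form `u ↦ ⟨u, x⟩`. -/
noncomputable def dotCLM {d : ℕ} (x : Fin d → ℝ) : (Fin d → ℝ) →L[ℝ] ℝ :=
  ∑ i, x i • ContinuousLinearMap.proj i

theorem dotCLM_apply {d : ℕ} (x u : Fin d → ℝ) : dotCLM x u = u ⬝ᵥ x := by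
  simp [dotCLM, dotProduct, mul_comm]

theorem continuous_dotCLM {d : ℕ} : Continuous (dotCLM : (Fin d → ℝ) → _) := by
  unfold dotCLM; fun_prop

/-- The norm on ℝ^d is the sup norm, whose dual is the ℓ¹ norm; for x ≥ 0 this is the sum of the
coordinates. -/
theorem norm_dotCLM_le {d : ℕ} {x : Fin d → ℝ} (hx : 0 ≤ x) : ‖dotCLM x‖ ≤ 1 ⬝ᵥ x := by
  refine ContinuousLinearMap.opNorm_le_bound _ (dotProduct_nonneg_of_nonneg zero_le_one hx)
    fun u => ?_
  rw [dotCLM_apply, one_dotProduct, Finset.sum_mul]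
  refine (norm_sum_le _ _).trans (Finset.sum_le_sum fun i _ => ?_)
  rw [norm_mul, mul_comm, Real.norm_of_nonneg (hx i)]
  exact mul_le_mul_of_nonneg_left (norm_le_pi_norm u i) (hx i)

/-! ### Regularity and strict monotonicity of the moment generating function. -/

section LaplaceTransform

variable {d : ℕ} {Ω : Type*} [MeasurableSpace Ω] {μ : Measure Ω} {Y : Ω → Fin d → ℝ}

/-- If `exp ⟨w, Y⟩` is integrable for `w` near `w₀`, where `Y ≥ 0`, then on a neighbourhood of `w₀`
these functions and their gradients are dominated by a single integrable function. -/
theorem exists_dominating (hY0 : ∀ ω, 0 ≤ Y ω) {w₀ : Fin d → ℝ}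
    (hw : ∀ᶠ w in 𝓝 w₀, Integrable (fun ω => Real.exp (w ⬝ᵥ Y ω)) μ) :
    ∃ g : Ω → ℝ, Integrable g μ ∧ ∀ᶠ w in 𝓝 w₀, ∀ ω,
      ‖Real.exp (w ⬝ᵥ Y ω) • dotCLM (Y ω)‖ ≤ g ω := by
  have hc : Tendsto (fun ε : ℝ => w₀ + ε • (1 : Fin d → ℝ)) (𝓝[>] 0) (𝓝 w₀) := by
    have : ContinuousAt (fun ε : ℝ => w₀ + ε • (1 : Fin d → ℝ)) 0 := by fun_prop
    have h := this.tendsto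
    rw [zero_smul, add_zero] at h
    exact h.mono_left nhdsWithin_le_nhds
  -- The shift ε𝟏 is spent in two halves: one bounds every w in the sup-norm ball of radius ε/2, the
  -- other absorbs the linear factor s = ⟨𝟏, Y⟩ of the gradient through s ≤ (2/ε) exp(εs/2).
  obtain ⟨ε, hε, hε0⟩ := ((hc.eventually hw).and self_mem_nhdsWithin).exists
  have hε0 : 0 < ε := hε0
  have h2 : 0 < ε / 2 := by positivity
  refine ⟨fun ω => (2 / ε) * Real.exp ((w₀ + ε • (1 : Fin d → ℝ)) ⬝ᵥ Y ω), hε.const_mul _, ?_⟩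
  filter_upwards [Metric.ball_mem_nhds w₀ h2] with w hwb ω
  have hS : 0 ≤ 1 ⬝ᵥ Y ω := dotProduct_nonneg_of_nonneg zero_le_one (hY0 ω)
  have hle : w ⬝ᵥ Y ω ≤ (w₀ + (ε / 2) • (1 : Fin d → ℝ)) ⬝ᵥ Y ω := by
    refine Finset.sum_le_sum fun i _ => mul_le_mul_of_nonneg_right ?_ (hY0 ω i)
    have h3 := (dist_le_pi_dist w w₀ i).trans (Metric.mem_ball.1 hwb).le
    rw [Real.dist_eq] at h3
    have h4 := (abs_le.1 h3).2
    simp only [Pi.add_apply, Pi.smul_apply, Pi.one_apply, smul_eq_mul, mul_one]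
    linarith
  rw [norm_smul, Real.norm_of_nonneg (Real.exp_pos _).le]
  calc _ ≤ Real.exp ((w₀ + (ε / 2) • (1 : Fin d → ℝ)) ⬝ᵥ Y ω) * (1 ⬝ᵥ Y ω) :=
        mul_le_mul (Real.exp_le_exp.2 hle) (norm_dotCLM_le (hY0 ω)) (norm_nonneg _)
          (Real.exp_pos _).le
    _ ≤ Real.exp ((w₀ + (ε / 2) • (1 : Fin d → ℝ)) ⬝ᵥ Y ω) *
          ((2 / ε) * Real.exp ((ε / 2) * (1 ⬝ᵥ Y ω))) := by
        refine mul_le_mul_of_nonneg_left ?_ (Real.exp_pos _).le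
        have h5 := Real.add_one_le_exp ((ε / 2) * (1 ⬝ᵥ Y ω))
        rw [div_mul_eq_mul_div, le_div_iff₀ hε0]
        nlinarith
    _ = _ := by
        rw [mul_left_comm, ← Real.exp_add]
        congr 2
        simp only [add_dotProduct, smul_dotProduct, smul_eq_mul]
        ring

/-- Differentiation under the integral sign: the same dominating function yields the derivative at
every nearby w and, by dominated convergence, its continuity. -/
theorem contDiffAt_integral_exp (hY : Measurable Y) (hY0 : ∀ ω, 0 ≤ Y ω) {w₀ : Fin d → ℝ}
    (hw : ∀ᶠ w in 𝓝 w₀, Integrable (fun ω => Real.exp (w ⬝ᵥ Y ω)) μ) :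
    ContDiffAt ℝ 1 (fun w => ∫ ω, Real.exp (w ⬝ᵥ Y ω) ∂μ) w₀ ∧
    Integrable (fun ω => Real.exp (w₀ ⬝ᵥ Y ω) • dotCLM (Y ω)) μ ∧
    HasFDerivAt (fun w => ∫ ω, Real.exp (w ⬝ᵥ Y ω) ∂μ)
      (∫ ω, Real.exp (w₀ ⬝ᵥ Y ω) • dotCLM (Y ω) ∂μ) w₀ := by
  have hdot : ∀ w : Fin d → ℝ, Measurable fun ω => Real.exp (w ⬝ᵥ Y ω) := fun w =>
    Real.measurable_exp.comp (Finset.measurable_sum _ fun i _ =>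
      ((measurable_pi_apply i).comp hY).const_mul (w i))
  have hm : ∀ w : Fin d → ℝ,
      AEStronglyMeasurable (fun ω => Real.exp (w ⬝ᵥ Y ω) • dotCLM (Y ω)) μ := fun w =>
    (hdot w).aestronglyMeasurable.smul
      (continuous_dotCLM.measurable.comp hY).aestronglyMeasurable
  have hder : ∀ (ω : Ω) (w : Fin d → ℝ), HasFDerivAt (fun w => Real.exp (w ⬝ᵥ Y ω))
      (Real.exp (w ⬝ᵥ Y ω) • dotCLM (Y ω)) w := by
    intro ω w
    have h := (dotCLM (Y ω)).hasFDerivAt (x := w)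
    rw [show (dotCLM (Y ω) : (Fin d → ℝ) → ℝ) = fun w => w ⬝ᵥ Y ω from
      funext (dotCLM_apply (Y ω))] at h
    exact h.exp
  obtain ⟨g, hg, hgb⟩ := exists_dominating hY0 hw
  have hF : ∀ᶠ w in 𝓝 w₀, HasFDerivAt (fun w => ∫ ω, Real.exp (w ⬝ᵥ Y ω) ∂μ)
      (∫ ω, Real.exp (w ⬝ᵥ Y ω) • dotCLM (Y ω) ∂μ) w := by
    filter_upwards [hw.eventually_nhds, hgb.eventually_nhds] with w h1 h2
    exact hasFDerivAt_integral_of_dominated_of_fderiv_le (bound := g) h2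
      (Eventually.of_forall fun w => (hdot w).aestronglyMeasurable) h1.self_of_nhds (hm w)
      (ae_of_all _ fun ω x hx => hx ω) hg (ae_of_all _ fun ω x _ => hder ω x)
  refine ⟨contDiffAt_one_iff.2 ⟨_, {w | _}, hF.and hgb.eventually_nhds, ?_, fun w hw => hw.1⟩,
    hg.mono' (hm _) (ae_of_all _ hgb.self_of_nhds), hF.self_of_nhds⟩
  intro w hw
  refine (continuousAt_of_dominated (bound := g) (Eventually.of_forall hm)
    (hw.2.mono fun x hx => ae_of_all _ hx) hg (ae_of_all _ fun ω => ?_)).continuousWithinAt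
  exact ((hder ω w).continuousAt.smul continuousAt_const)

/-- The gradient of the Laplace transform is strictly positive. -/
theorem integral_exp_smul_dotCLM_pos (hY0 : ∀ ω, 0 ≤ Y ω)
    (hne : ∀ i, ¬ ∀ᵐ ω ∂μ, Y ω i = 0) {w v : Fin d → ℝ} (hv : 0 ≤ v) (hv0 : v ≠ 0)
    (hint : Integrable (fun ω => Real.exp (w ⬝ᵥ Y ω) • dotCLM (Y ω)) μ) :
    0 < (∫ ω, Real.exp (w ⬝ᵥ Y ω) • dotCLM (Y ω) ∂μ) v := by
  rw [ContinuousLinearMap.integral_apply hint]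
  have hval : ∀ ω, (Real.exp (w ⬝ᵥ Y ω) • dotCLM (Y ω)) v = Real.exp (w ⬝ᵥ Y ω) * (v ⬝ᵥ Y ω) := by
    intro ω; simp [dotCLM_apply]
  have hnn : ∀ ω, 0 ≤ (Real.exp (w ⬝ᵥ Y ω) • dotCLM (Y ω)) v := fun ω => by
    rw [hval]
    exact mul_nonneg (Real.exp_pos _).le (dotProduct_nonneg_of_nonneg hv (hY0 ω))
  refine lt_of_le_of_ne (integral_nonneg hnn) fun h => ?_
  rw [eq_comm, integral_eq_zero_iff_of_nonneg hnn (hint.apply_continuousLinearMap v)] at h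
  obtain ⟨i, hi⟩ := Function.ne_iff.1 hv0
  refine hne i ?_
  filter_upwards [h] with ω hω
  rw [hval, Pi.zero_apply] at hω
  have h1 := (mul_eq_zero.1 hω).resolve_left (Real.exp_pos _).ne'
  have h2 := (Finset.sum_eq_zero_iff_of_nonneg fun j _ => mul_nonneg (hv j) (hY0 ω j)).1 h1 i
    (Finset.mem_univ i)
  exact (mul_eq_zero.1 h2).resolve_left hi

/-- Equality would make the ordered exponents agree almost surely, so Y_i would vanish for a
coordinate i where w_i < w'_i. -/
theorem integral_exp_lt (hY0 : ∀ ω, 0 ≤ Y ω)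
    (hne : ∀ i, ¬ ∀ᵐ ω ∂μ, Y ω i = 0) {w w' : Fin d → ℝ} (h : w < w')
    (hw : Integrable (fun ω => Real.exp (w ⬝ᵥ Y ω)) μ)
    (hw' : Integrable (fun ω => Real.exp (w' ⬝ᵥ Y ω)) μ) :
    ∫ ω, Real.exp (w ⬝ᵥ Y ω) ∂μ < ∫ ω, Real.exp (w' ⬝ᵥ Y ω) ∂μ := by
  obtain ⟨hle, i, hi⟩ := Pi.lt_def.1 h
  have hdle : ∀ ω, w ⬝ᵥ Y ω ≤ w' ⬝ᵥ Y ω := fun ω =>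
    Finset.sum_le_sum fun j _ => mul_le_mul_of_nonneg_right (hle j) (hY0 ω j)
  have hnn : ∀ ω, 0 ≤ Real.exp (w' ⬝ᵥ Y ω) - Real.exp (w ⬝ᵥ Y ω) := fun ω =>
    sub_nonneg.2 (Real.exp_le_exp.2 (hdle ω))
  rw [← sub_pos, ← integral_sub hw' hw]
  refine lt_of_le_of_ne (integral_nonneg hnn) fun h => ?_
  rw [eq_comm, integral_eq_zero_iff_of_nonneg hnn (hw'.sub hw)] at h
  refine hne i ?_
  filter_upwards [h] with ω hω
  have h1 : w ⬝ᵥ Y ω = w' ⬝ᵥ Y ω := (Real.exp_injective (sub_eq_zero.1 hω)).symm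
  have h2 := (Finset.sum_eq_sum_iff_of_le fun j _ =>
    mul_le_mul_of_nonneg_right (hle j) (hY0 ω j)).1 h1 i (Finset.mem_univ i)
  by_contra h3
  exact hi.ne (mul_right_cancel₀ h3 h2)

end LaplaceTransform

/-! ### Submanifolds that are chains: dimension at most one, and local inverses. -/

section Chains

theorem convex_slice (d k : ℕ) : Convex ℝ (slice d k) := by
  intro x hx y hy a b _ _ _ i hi
  simp [hx i hi, hy i hi]

theorem convex_halfSlice (d k : ℕ) : Convex ℝ (halfSlice d k) := by
  intro x hx y hy a b ha hb hab
  refine ⟨convex_slice d k hx.1 hy.1 ha hb hab, fun i hi => ?_⟩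
  exact add_nonneg (mul_nonneg ha (hx.2 i hi)) (mul_nonneg hb (hy.2 i hi))

theorem add_single_mem_slice {d k : ℕ} {y : Fin d → ℝ} (hy : y ∈ slice d k) {i : Fin d}
    (hi : (i : ℕ) < k) (ε : ℝ) : y + Pi.single i ε ∈ slice d k := by
  intro j hj
  have hji : j ≠ i := by rintro rfl; omega
  simp [hy j hj, hji]

theorem add_single_mem_halfSlice {d k : ℕ} {y : Fin d → ℝ} (hy : y ∈ halfSlice d k) {i : Fin d}
    (hi : (i : ℕ) < k) {ε : ℝ} (hε : 0 ≤ ε) : y + Pi.single i ε ∈ halfSlice d k :=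
  ⟨add_single_mem_slice hy.1 hi ε, fun j hj =>
    add_nonneg (hy.2 j hj) ((Pi.single_nonneg.2 hε : 0 ≤ (Pi.single i ε : Fin d → ℝ)) j)⟩

/-- A continuous injective real function on a convex set is monotone along segments. -/
theorem mem_segment_of_injOn {E : Type*} [AddCommGroup E] [Module ℝ E] [TopologicalSpace E]
    [ContinuousAdd E] [ContinuousSMul ℝ E] {C : Set E} (hC : Convex ℝ C)
    {g : E → ℝ} (hg : ContinuousOn g C) (hi : InjOn g C) {a b c : E} (ha : a ∈ C) (hb : b ∈ C)
    (hc : c ∈ C) (hab : g a ≤ g b) (hbc : g b ≤ g c) : b ∈ segment ℝ a c := by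
  have hs := hC.segment_subset ha hc
  have hpre : IsPreconnected (g '' segment ℝ a c) :=
    (convex_segment a c).isPreconnected.image g (hg.mono hs)
  obtain ⟨x, hx, hxb⟩ := hpre.Icc_subset (mem_image_of_mem g (left_mem_segment ℝ a c))
    (mem_image_of_mem g (right_mem_segment ℝ a c)) ⟨hab, hbc⟩
  rwa [← hi (hs hx) hb hxb]

/-- A convex set on which some continuous real function is injective contains no right angle. -/
theorem false_of_injOn_of_triangle {d : ℕ} {C : Set (Fin d → ℝ)} (hC : Convex ℝ C)
    {g : (Fin d → ℝ) → ℝ} (hg : ContinuousOn g C) (hinj : InjOn g C) {y : Fin d → ℝ} {i j : Fin d}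
    (hij : i ≠ j) {ε : ℝ} (hε : 0 < ε) (hy : y ∈ C) (hyi : y + Pi.single i ε ∈ C)
    (hyj : y + Pi.single j ε ∈ C) : False := by
  have h1 : y ∉ segment ℝ (y + Pi.single i ε) (y + Pi.single j ε) := by
    rintro ⟨s, t, hs, ht, hst, h⟩
    have hi := congrFun h i
    have hj := congrFun h j
    simp [hij, hij.symm] at hi hj
    have e1 : s * ε = 0 := by linear_combination hi - y i * hst
    have e2 : t * ε = 0 := by linear_combination hj - y j * hst
    nlinarith
  have h2 : ∀ {i j : Fin d}, i ≠ j → y + Pi.single i ε ∉ segment ℝ y (y + Pi.single j ε) := by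
    rintro i j hij ⟨s, t, hs, ht, hst, h⟩
    have hi := congrFun h i
    simp [hij] at hi
    have e1 : ε = 0 := by linear_combination y i * hst - hi
    exact hε.ne' e1
  have h1' := h1
  have h2' := h2 hij
  have h3' := h2 hij.symm
  rw [segment_symm] at h1' h2' h3'
  -- Whichever vertex has the middle value of g would have to lie on the segment joining the other
  -- two.
  rcases le_total (g y) (g (y + Pi.single i ε)) with ha | ha <;>
  rcases le_total (g y) (g (y + Pi.single j ε)) with hb | hb <;>
  rcases le_total (g (y + Pi.single i ε)) (g (y + Pi.single j ε)) with hc | hc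
  · exact h2 hij (mem_segment_of_injOn hC hg hinj hy hyi hyj ha hc)
  · exact h2 hij.symm (mem_segment_of_injOn hC hg hinj hy hyj hyi hb hc)
  · exact h1' (mem_segment_of_injOn hC hg hinj hyj hy hyi hb ha)
  · exact h1' (mem_segment_of_injOn hC hg hinj hyj hy hyi hb ha)
  · exact h1 (mem_segment_of_injOn hC hg hinj hyi hy hyj ha hb)
  · exact h1 (mem_segment_of_injOn hC hg hinj hyi hy hyj ha hb)
  · exact h3' (mem_segment_of_injOn hC hg hinj hyi hyj hy hc hb)
  · exact h2' (mem_segment_of_injOn hC hg hinj hyj hyi hy hc ha)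

variable {d k : ℕ} {M : Set (Fin d → ℝ)} {F : (Fin d → ℝ) → ℝ}

/-- The velocity at `s₀` of a curve that runs in a chain after time `s₀` is nonnegative or
nonpositive. -/
theorem nonneg_or_nonpos_of_hasDerivAt {γ : ℝ → Fin d → ℝ} {v : Fin d → ℝ} {s₀ : ℝ}
    (hγ : HasDerivAt γ v s₀) (hch : ∀ᶠ s in 𝓝[>] s₀, γ s₀ ≤ γ s ∨ γ s ≤ γ s₀) :
    0 ≤ v ∨ v ≤ 0 := by
  have hlim : Tendsto (slope γ s₀) (𝓝[>] s₀) (𝓝 v) :=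
    (hasDerivAt_iff_tendsto_slope.1 hγ).mono_left (nhdsWithin_mono _ fun s hs => (ne_of_gt hs))
  refine (isClosed_Ici.union isClosed_Iic : IsClosed (Ici (0 : Fin d → ℝ) ∪ Iic 0)).mem_of_tendsto
    hlim ?_
  filter_upwards [hch, self_mem_nhdsWithin] with s hs hs0
  have h0 : 0 ≤ (s - s₀)⁻¹ := inv_nonneg.2 (sub_nonneg.2 (le_of_lt hs0))
  rw [slope_def_module]
  rcases hs with hs | hs
  · exact Or.inl (smul_nonneg h0 (sub_nonneg.2 hs))
  · exact Or.inr (smul_nonpos_of_nonneg_of_nonpos h0 (sub_nonpos.2 hs))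

/-- On a `C¹`-submanifold that is a chain, a `C¹`-function with strictly positive gradient has
local left inverses of class `C¹`. -/
theorem IsC1Submanifold.exists_contDiffAt_leftInverse (hM : IsC1Submanifold k M)
    (hch : ∀ x ∈ M, ∀ y ∈ M, x ≤ y ∨ y ≤ x) (hinj : InjOn F M)
    (hF : ∀ p ∈ M, ContDiffAt ℝ 1 F p)
    (hpos : ∀ p ∈ M, ∀ v : Fin d → ℝ, 0 ≤ v → v ≠ 0 → 0 < fderiv ℝ F p v)
    {p : Fin d → ℝ} (hp : p ∈ M) :
    ∃ h : ℝ → Fin d → ℝ, ContDiffAt ℝ 1 h (F p) ∧ ∀ᶠ w in 𝓝[M] p, h (F w) = w := by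
  obtain ⟨Φ, hpΦ, hΦ, hΦs, hcase⟩ := hM p hp
  -- Interior and boundary charts are treated together: only convexity and stability under
  -- nonnegative steps in the first k coordinates are needed.
  obtain ⟨S, hS, hSsl, hSconv, hSadd⟩ : ∃ S : Set (Fin d → ℝ), Φ.IsImage M S ∧ S ⊆ slice d k ∧
      Convex ℝ S ∧ ∀ y ∈ S, ∀ i : Fin d, (i : ℕ) < k → ∀ ε : ℝ, 0 ≤ ε → y + Pi.single i ε ∈ S := by
    rcases hcase with h | h
    · exact ⟨_, h, Subset.rfl, convex_slice d k, fun y hy i hi ε _ => add_single_mem_slice hy hi ε⟩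
    · exact ⟨_, h, fun y hy => hy.1, convex_halfSlice d k,
        fun y hy i hi ε hε => add_single_mem_halfSlice hy hi hε⟩
  have hyt : Φ p ∈ Φ.target := Φ.map_source hpΦ
  have hyS : Φ p ∈ S := (hS hpΦ).2 hp
  have hsymm : ∀ y ∈ Φ.target, y ∈ S → Φ.symm y ∈ M := fun y hy hyS => (hS.symm hy).2 hyS
  have hsrc : ∀ᶠ w in 𝓝[M] p, w ∈ Φ.source ∧ w ∈ M :=
    (eventually_nhdsWithin_of_eventually_nhds (Φ.open_source.mem_nhds hpΦ)).and self_mem_nhdsWithin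
  -- A second chart direction would place a right triangle in the chart, where F ∘ Φ⁻¹ is continuous
  -- and injective.
  by_cases hk : ∃ i : Fin d, (i : ℕ) < k ∧ (i : ℕ) ≠ 0
  · exfalso
    obtain ⟨i, hik, hi0⟩ := hk
    obtain ⟨r, hr, hball⟩ := Metric.isOpen_iff.1 Φ.open_target _ hyt
    have hmem : ∀ j : Fin d, (j : ℕ) < k →
        Φ p + Pi.single j (r / 2) ∈ Metric.ball (Φ p) r ∩ S := by
      intro j hj
      refine ⟨?_, hSadd _ hyS j hj _ (by positivity)⟩
      rw [mem_ball_iff_norm, add_sub_cancel_left, Pi.norm_single, Real.norm_of_nonneg (by positivity)]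
      linarith
    refine false_of_injOn_of_triangle ((convex_ball (Φ p) r).inter hSconv) (g := F ∘ Φ.symm) ?_ ?_
      (i := i) (j := ⟨0, i.pos⟩) (fun h => hi0 (by rw [h])) (half_pos hr)
      ⟨Metric.mem_ball_self hr, hyS⟩ (hmem i hik) (hmem _ (by simp; omega))
    · intro y hy
      have h1 := hball hy.1
      exact ((hF _ (hsymm y h1 hy.2)).continuousAt.comp
        (Φ.symm.continuousAt h1)).continuousWithinAt
    · intro y hy z hz hyz
      exact Φ.symm.injOn (hball hy.1) (hball hz.1)
        (hinj (hsymm y (hball hy.1) hy.2) (hsymm z (hball hz.1) hz.2) hyz)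
  push Not at hk
  by_cases hd : 0 < d ∧ 0 < k
  · obtain ⟨hd, hk0⟩ := hd
    set i₀ : Fin d := ⟨0, hd⟩ with hi₀
    have hsingle : ∀ y ∈ S, Pi.single i₀ (y i₀) = y := by
      intro y hy
      ext j
      by_cases hj : j = i₀
      · subst hj; simp
      · rw [Pi.single_eq_of_ne hj]
        refine (hSsl hy j ?_).symm
        by_contra! hjk
        exact hj (Fin.ext (hk j hjk))
    set s₀ := Φ p i₀ with hs₀
    have hy₀ : Pi.single i₀ s₀ = Φ p := hsingle _ hyS
    let ℓ : ℝ →L[ℝ] (Fin d → ℝ) := ContinuousLinearMap.single ℝ (fun _ : Fin d => ℝ) i₀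
    have hℓ : ∀ s, ℓ s = Pi.single i₀ s := fun s => rfl
    set γ : ℝ → Fin d → ℝ := fun s => Φ.symm (ℓ s) with hγdef
    have hγ₀ : γ s₀ = p := by simp only [hγdef, hℓ, hy₀, Φ.left_inv hpΦ]
    have hℓt : ∀ᶠ s in 𝓝 s₀, ℓ s ∈ Φ.target :=
      ℓ.continuous.continuousAt (Φ.open_target.mem_nhds (by rwa [hℓ, hy₀]))
    have hγ : ContDiffAt ℝ 1 γ s₀ := by
      refine ContDiffAt.comp s₀ ?_ ℓ.contDiff.contDiffAt
      exact hΦs.contDiffAt (Φ.open_target.mem_nhds (by rwa [hℓ, hy₀]))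
    have hγd : HasDerivAt γ (deriv γ s₀) s₀ := (hγ.differentiableAt one_ne_zero).hasDerivAt
    -- Differentiating Φ ∘ γ = ℓ gives DΦ(γ') = ℓ(1) ≠ 0.
    have hv0 : deriv γ s₀ ≠ 0 := by
      intro h0
      have hΦd : HasFDerivAt Φ (fderiv ℝ Φ p) (γ s₀) := by
        rw [hγ₀]
        exact ((hΦ.contDiffAt (Φ.open_source.mem_nhds hpΦ)).differentiableAt
          one_ne_zero).hasFDerivAt
      have h1 := hΦd.comp_hasDerivAt s₀ hγd
      have h2 : HasDerivAt ℓ (ℓ 1) s₀ := ℓ.hasDerivAt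
      have h3 : HasDerivAt ℓ (fderiv ℝ Φ p (deriv γ s₀)) s₀ :=
        h1.congr_of_eventuallyEq (hℓt.mono fun s hs => (Φ.right_inv hs).symm)
      have h4 := congrFun (h2.unique h3) i₀
      rw [h0, map_zero, hℓ, Pi.single_eq_same] at h4
      exact one_ne_zero h4
    -- Only s > s₀ is used: at a boundary point, γ is defined on both sides of s₀ but need lie in M
    -- only on the right.
    have hsign : 0 ≤ deriv γ s₀ ∨ deriv γ s₀ ≤ 0 := by
      refine nonneg_or_nonpos_of_hasDerivAt hγd ?_
      filter_upwards [nhdsWithin_le_nhds hℓt, self_mem_nhdsWithin] with s hs hs0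
      refine hch _ (by rwa [hγ₀]) _ (hsymm _ hs ?_)
      have h1 := hSadd _ hyS i₀ hk0 (s - s₀) (sub_nonneg.2 (le_of_lt hs0))
      rwa [← hy₀, ← Pi.single_add, add_sub_cancel] at h1
    have hFd : HasFDerivAt F (fderiv ℝ F p) (γ s₀) := by
      rw [hγ₀]; exact ((hF p hp).differentiableAt one_ne_zero).hasFDerivAt
    have hne : fderiv ℝ F p (deriv γ s₀) ≠ 0 := by
      rcases hsign with h | h
      · exact (hpos p hp _ h hv0).ne'
      · have := hpos p hp _ (neg_nonneg.2 h) (neg_ne_zero.2 hv0)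
        rw [map_neg] at this
        exact (neg_pos.1 this).ne
    have hg : ContDiffAt ℝ 1 (F ∘ γ) s₀ := ContDiffAt.comp s₀ (by rw [hγ₀]; exact hF p hp) hγ
    have hgd : HasFDerivAt (F ∘ γ) ((ContinuousLinearEquiv.unitsEquivAut ℝ (Units.mk0 _ hne) :
        ℝ ≃L[ℝ] ℝ) : ℝ →L[ℝ] ℝ) s₀ := by
      have h1 := (hFd.comp_hasDerivAt s₀ hγd).hasFDerivAt
      rwa [show ContinuousLinearMap.toSpanSingleton ℝ (fderiv ℝ F p (deriv γ s₀)) =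
        ((ContinuousLinearEquiv.unitsEquivAut ℝ (Units.mk0 _ hne) : ℝ ≃L[ℝ] ℝ) : ℝ →L[ℝ] ℝ) by
          ext; simp] at h1
    have hleft : ∀ᶠ s in 𝓝 s₀, hg.localInverse hgd one_ne_zero ((F ∘ γ) s) = s :=
      (hg.hasStrictFDerivAt' hgd one_ne_zero).eventually_left_inverse
    refine ⟨γ ∘ hg.localInverse hgd one_ne_zero, ?_, ?_⟩
    · have h1 := hg.to_localInverse hgd one_ne_zero
      have h2 := hleft.self_of_nhds
      have h3 : (F ∘ γ) s₀ = F p := by rw [Function.comp_apply, hγ₀]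
      rw [h3] at h1 h2
      exact ContDiffAt.comp _ (by rwa [h2]) h1
    · have hcont : Tendsto (fun w => Φ w i₀) (𝓝[M] p) (𝓝 s₀) :=
        (((continuous_apply i₀).continuousAt).comp (Φ.continuousAt hpΦ)).mono_left
          nhdsWithin_le_nhds
      filter_upwards [hcont.eventually hleft, hsrc] with w hw hwM
      have h1 : γ (Φ w i₀) = w := by
        simp only [hγdef, hℓ]
        rw [hsingle _ ((hS hwM.1).2 hwM.2), Φ.left_inv hwM.1]
      rw [Function.comp_apply, h1] at hw
      rw [Function.comp_apply, hw, h1]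
  -- In dimension zero M reduces to the point p near p, so a constant inverse suffices.
  · refine ⟨fun _ => p, contDiffAt_const, ?_⟩
    have hz : ∀ y ∈ S, y = 0 := by
      intro y hy
      ext j
      refine hSsl hy j ?_
      have := j.pos
      omega
    filter_upwards [hsrc] with w hw
    exact Φ.injOn hpΦ hw.1 ((hz _ hyS).trans (hz _ ((hS hw.1).2 hw.2)).symm)

end Chains

/-! ### Continuity by compactness, and calculus on closed intervals. -/

/-- A parametrized curve in a compact set on which the values of a continuous injective function
are continuous is continuous. -/
theorem continuousOn_of_comp_injOn {X E : Type*} [TopologicalSpace X] [TopologicalSpace E]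
    {s : Set X} {M : Set E} (hM : IsCompact M) {F : E → ℝ} (hF : ∀ p ∈ M, ContinuousAt F p)
    (hinj : InjOn F M) {U : X → E} (hU : MapsTo U s M) (hFU : ContinuousOn (F ∘ U) s) :
    ContinuousOn U s := by
  intro t ht
  -- By compactness it suffices that U(t) is the only cluster point of U at t; a cluster point y
  -- satisfies F(y) = F(U(t)), and F is injective on M.
  refine hM.tendsto_nhds_of_unique_mapClusterPt (eventually_mem_nhdsWithin.mono fun x hx => hU hx)
    fun y hy hcl => hinj hy (hU ht) ?_
  have h1 : MapClusterPt (F y) (𝓝[s] t) (F ∘ U) := hcl.continuousAt_comp (hF y hy)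
  have h2 : Tendsto (F ∘ U) (𝓝[s] t) (𝓝 (F (U t))) := hFU t ht
  by_contra hne
  exact (disjoint_nhds_nhds.2 hne).le_bot.not_gt
    (bot_lt_iff_ne_bot.2 ((ClusterPt.mono h1 h2).ne))

/-- Extending f by its endpoint values makes it continuous on all of ℝ without changing the
integrals, so the fundamental theorem of calculus applies at the endpoints as well. -/
theorem contDiffOn_integral_left {f : ℝ → ℝ} {a b : ℝ} (hab : a ≤ b)
    (hf : ContinuousOn f (Icc a b)) : ContDiffOn ℝ 1 (fun t => ∫ s in t..b, f s) (Icc a b) := by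
  set g := IccExtend hab (domRestrict (Icc a b) f) with hg
  have hgc : Continuous g := continuousOn_iff_continuous_domRestrict.1 hf |>.Icc_extend'
  have hder : ∀ t, HasDerivAt (fun t => ∫ s in t..b, g s) (-g t) t := fun t =>
    intervalIntegral.integral_hasDerivAt_left (hgc.intervalIntegrable _ _)
      (hgc.stronglyMeasurableAtFilter _ _) hgc.continuousAt
  have hC : ContDiff ℝ 1 (fun t => ∫ s in t..b, g s) := by
    refine contDiff_one_iff_deriv.2 ⟨fun t => (hder t).differentiableAt, ?_⟩
    rw [funext fun t => (hder t).deriv]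
    exact hgc.neg
  refine hC.contDiffOn.congr fun t ht => ?_
  refine intervalIntegral.integral_congr fun s hs => ?_
  rw [uIcc_of_le ht.2] at hs
  exact (IccExtend_of_mem hab (domRestrict (Icc a b) f) ⟨ht.1.trans hs.1, hs.2⟩).symm

/-- A `C¹`-function on a compact interval has bounded right-hand derivatives. -/
theorem exists_bounded_rightDeriv {E : Type*} [NormedAddCommGroup E] [NormedSpace ℝ E]
    {U : ℝ → E} {a b : ℝ} (hab : a < b) (hU : ContDiffOn ℝ 1 U (Icc a b)) :
    ∃ (U' : ℝ → E) (C : ℝ), ∀ t ∈ Ico a b, HasDerivWithinAt U (U' t) (Ioi t) t ∧ ‖U' t‖ ≤ C := by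
  obtain ⟨C, hC⟩ := isCompact_Icc.exists_bound_of_continuousOn
    (hU.continuousOn_derivWithin (uniqueDiffOn_Icc hab) le_rfl)
  refine ⟨derivWithin U (Icc a b), C, fun t ht => ⟨?_, hC t (Ico_subset_Icc_self ht)⟩⟩
  exact ((hU.differentiableOn one_ne_zero t (Ico_subset_Icc_self ht)).hasDerivWithinAt).mono_of_mem_nhdsWithin
    (Icc_mem_nhdsGT_of_mem ht)

/-! ### The function w ↦ M_0^w of the model. -/

namespace Model

variable {d : ℕ} {Ω : Type*} [MeasurableSpace Ω] (L : Model d Ω)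

theorem TN_pos : 0 < L.TN :=
  mul_pos (Nat.cast_pos.2 L.N_pos) L.δ_pos

theorem measurable_X_TN : Measurable (L.Z.X L.TN) :=
  L.Z.measurable_X ⟨L.TN_pos.le, le_rfl⟩

theorem not_ae_eq_zero (i : Fin d) : ¬ ∀ᵐ ω ∂(L.Z.P 1), toVec (L.Z.X L.TN ω) i = 0 := by
  intro h
  refine L.Z.not_ae_eq_zero L.TN_pos i ?_
  filter_upwards [h] with ω hω
  exact NNReal.coe_eq_zero.1 hω

theorem M₀_zero : L.M₀ 0 = 1 := by
  simp [M₀]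

theorem M₀_eq_exp {w : Fin d → ℝ} (hw : w ∈ L.Z.I) :
    L.M₀ w = Real.exp (L.Z.φ L.TN w + L.Z.ψ L.TN w ⬝ᵥ (1 : Fin d → ℝ)) := by
  rw [← toVec_one]
  exact L.Z.affine _ ⟨L.TN_pos.le, le_rfl⟩ w hw 1

theorem M₀_lt {w w' : Fin d → ℝ} (hw : w ∈ L.Z.I) (hw' : w' ∈ L.Z.I) (h : w < w') :
    L.M₀ w < L.M₀ w' :=
  integral_exp_lt (fun _ => toVec_nonneg _) L.not_ae_eq_zero h (hw 1) (hw' 1)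

theorem contDiffAt_M₀ {w : Fin d → ℝ} (hw : w ∈ interior L.Z.I) :
    ContDiffAt ℝ 1 L.M₀ w ∧
      ∀ v : Fin d → ℝ, 0 ≤ v → v ≠ 0 → 0 < fderiv ℝ L.M₀ w v := by
  obtain ⟨h1, h2, h3⟩ := contDiffAt_integral_exp (μ := L.Z.P 1)
    (Y := fun ω => toVec (L.Z.X L.TN ω)) (measurable_toVec.comp L.measurable_X_TN)
    (fun _ => toVec_nonneg _) (w₀ := w)
    (((isOpen_interior.mem_nhds hw) |> eventually_mem_set.2).mono fun w hw => interior_subset hw 1)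
  refine ⟨h1, fun v hv hv0 => ?_⟩
  have h4 : fderiv ℝ L.M₀ w = _ := h3.fderiv
  rw [h4]
  exact integral_exp_smul_dotCLM_pos (fun _ => toVec_nonneg _) L.not_ae_eq_zero hv hv0 h2

/-- On a chain in `𝓘_T`, comparison of the values of `M₀` amounts to comparison of the
arguments. -/
theorem le_of_M₀_le {M : Set (Fin d → ℝ)} (hM : M ⊆ L.Z.I)
    (hch : ∀ x ∈ M, ∀ y ∈ M, x ≤ y ∨ y ≤ x) {x y : Fin d → ℝ} (hx : x ∈ M) (hy : y ∈ M)
    (h : L.M₀ x ≤ L.M₀ y) : x ≤ y := by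
  rcases hch x hx y hy with h1 | h1
  · exact h1
  · rcases h1.eq_or_lt with h2 | h2
    · exact h2.ge
    · exact absurd (L.M₀_lt (hM hy) (hM hx) h2) h.not_gt

theorem injOn_M₀ {M : Set (Fin d → ℝ)} (hM : M ⊆ L.Z.I)
    (hch : ∀ x ∈ M, ∀ y ∈ M, x ≤ y ∨ y ≤ x) : InjOn L.M₀ M := fun _ hx _ hy h =>
  le_antisymm (L.le_of_M₀_le hM hch hx hy h.le) (L.le_of_M₀_le hM hch hy hx h.ge)

end Model

end AffineLIBOR

/-! ### Construction, regularity and uniqueness of the fitting curve. -/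

theorem proposition4p10 {d k : ℕ} {Ω : Type*} [MeasurableSpace Ω] (L : AffineLIBOR.Model d Ω)
    -- the initial discount factors `B(0,T_l)`, to which the sequence `u` is fitted
    (B : ℕ → ℝ)
    (hB : ∀ l, 1 ≤ l → l ≤ L.N → L.M₀ (L.u l) = B l / B L.N)
    -- the initial forward curve, consistent with the initial discount factors
    (f : ℝ → ℝ) (hf : ContinuousOn f (Set.Icc 0 L.TN)) (hf0 : ∀ t ∈ Set.Icc 0 L.TN, 0 ≤ f t)
    (hfB : ∀ l, 1 ≤ l → l ≤ L.N → B l = Real.exp (-∫ s in (0 : ℝ)..L.time l, f s))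
    -- the manifold, which is the image of an interpolating function
    (M : Set (Fin d → ℝ)) (hM : AffineLIBOR.IsC1Submanifold k M)
    (hMI : M ⊆ interior L.Z.I ∩ {w | 0 ≤ w})
    (U₀ : ℝ → Fin d → ℝ) (hU₀ : L.IsInterpolating U₀) (hU₀M : U₀ '' Set.Icc 0 L.TN = M)
    (hU₀0 : L.M₀ (U₀ 0) = 1 / B L.N) :
    ∃ U : ℝ → Fin d → ℝ, L.IsFittingInterpolation f M U ∧
      ∀ V : ℝ → Fin d → ℝ, L.IsFittingInterpolation f M V → Set.EqOn V U (Set.Icc 0 L.TN) := by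
  have hT := L.TN_pos
  have hIM : M ⊆ L.Z.I := fun w hw => interior_subset (hMI hw).1
  have hch : ∀ x ∈ M, ∀ y ∈ M, x ≤ y ∨ y ≤ x := by
    rw [← hU₀M]
    rintro _ ⟨s, hs, rfl⟩ _ ⟨t, ht, rfl⟩
    rcases le_total s t with h | h
    · exact Or.inr (hU₀.antitoneOn hs ht h)
    · exact Or.inl (hU₀.antitoneOn ht hs h)
  have hinj : InjOn L.M₀ M := L.injOn_M₀ hIM hch
  have hcomp : IsCompact M := hU₀M ▸ isCompact_Icc.image_of_continuousOn hU₀.continuousOn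
  have hdiff : ∀ p ∈ M, ContDiffAt ℝ 1 L.M₀ p := fun p hp => (L.contDiffAt_M₀ (hMI hp).1).1
  have hmaps : MapsTo U₀ (Icc 0 L.TN) M := fun t ht => hU₀M ▸ mem_image_of_mem U₀ ht
  have hint : ∀ a ∈ Icc 0 L.TN, ∀ b ∈ Icc 0 L.TN, IntervalIntegrable f volume a b :=
    fun a ha b hb => (hf.mono (uIcc_subset_Icc ha hb)).intervalIntegrable
  have h0m : (0 : ℝ) ∈ Icc 0 L.TN := ⟨le_rfl, hT.le⟩
  have hTm : L.TN ∈ Icc 0 L.TN := ⟨hT.le, le_rfl⟩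
  have hanti : ∀ s ∈ Icc 0 L.TN, ∀ t ∈ Icc 0 L.TN, s ≤ t →
      ∫ x in t..L.TN, f x ≤ ∫ x in s..L.TN, f x := by
    intro s hs t ht hst
    rw [← intervalIntegral.integral_add_adjacent_intervals (hint s hs t ht) (hint t ht _ hTm)]
    have := intervalIntegral.integral_nonneg hst (f := f) (μ := volume)
      fun x hx => hf0 x ⟨hs.1.trans hx.1, hx.2.trans ht.2⟩
    linarith
  have hBN : B L.N = Real.exp (-∫ s in (0 : ℝ)..L.TN, f s) := hfB _ L.N_pos le_rfl
  have hU₀T : U₀ L.TN = 0 := (hU₀.interpolates _ L.N_pos le_rfl).trans L.u_last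
  -- Since f ≥ 0, the target lies between 1 = M_0^{Û(T_N)} and exp ∫_0^{T_N} f = 1/B(0,T_N) =
  -- M_0^{Û(0)}.
  have hex : ∀ t ∈ Icc 0 L.TN, ∃ w ∈ M, L.M₀ w = Real.exp (∫ s in t..L.TN, f s) := by
    intro t ht
    have hc : ContinuousOn (L.M₀ ∘ U₀) (Icc 0 L.TN) :=
      ContinuousOn.comp (fun p hp => (hdiff p hp).continuousAt.continuousWithinAt)
        hU₀.continuousOn hmaps
    have hmem : Real.exp (∫ s in t..L.TN, f s) ∈ Icc ((L.M₀ ∘ U₀) L.TN) ((L.M₀ ∘ U₀) 0) := by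
      constructor
      · rw [Function.comp_apply, hU₀T, L.M₀_zero, Real.one_le_exp_iff]
        simpa using hanti t ht _ hTm ht.2
      · rw [Function.comp_apply, hU₀0, hBN, one_div, ← Real.exp_neg, neg_neg, Real.exp_le_exp]
        exact hanti 0 h0m t ht ht.1
    obtain ⟨s, hs, hst⟩ := intermediate_value_Icc' hT.le hc hmem
    exact ⟨U₀ s, hmaps hs, hst⟩
  choose! U hUM hUE using hex
  have hEC : ContDiffOn ℝ 1 (fun t => Real.exp (∫ s in t..L.TN, f s)) (Icc 0 L.TN) :=
    (AffineLIBOR.contDiffOn_integral_left hT.le hf).exp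
  have hUc : ContinuousOn U (Icc 0 L.TN) :=
    AffineLIBOR.continuousOn_of_comp_injOn hcomp (fun p hp => (hdiff p hp).continuousAt) hinj hUM
      (hEC.continuousOn.congr hUE)
  -- Near t, U is a local C¹ inverse of M_0 on M composed with s ↦ exp ∫_s^{T_N} f. Continuity of U
  -- is needed first, so that U(s) stays where this inverse is valid.
  have hUC : ContDiffOn ℝ 1 U (Icc 0 L.TN) := by
    intro t ht
    obtain ⟨h, hh, hhe⟩ := hM.exists_contDiffAt_leftInverse hch hinj hdiff
      (fun p hp => (L.contDiffAt_M₀ (hMI hp).1).2) (hUM t ht)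
    have hlim : Tendsto U (𝓝[Icc 0 L.TN] t) (𝓝[M] (U t)) :=
      tendsto_nhdsWithin_iff.2 ⟨hUc t ht, eventually_mem_nhdsWithin.mono hUM⟩
    rw [hUE t ht] at hh
    refine (hh.comp_contDiffWithinAt t (hEC t ht)).congr_of_eventuallyEq_of_mem ?_ ht
    filter_upwards [hlim.eventually hhe, self_mem_nhdsWithin] with s hs hsm
    rw [Function.comp_apply, ← hUE s hsm, hs]
  refine ⟨U, ⟨⟨hUc, ?_, fun t ht => (hMI (hUM t ht)).2, fun t ht => hIM (hUM t ht),
    AffineLIBOR.exists_bounded_rightDeriv hT hUC, ?_⟩, hUC, hUM, ?_⟩, ?_⟩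
  · intro s hs t ht hst
    refine L.le_of_M₀_le hIM hch (hUM t ht) (hUM s hs) ?_
    rw [hUE t ht, hUE s hs, Real.exp_le_exp]
    exact hanti s hs t ht hst
  · intro l hl hlN
    have hlm : L.time l ∈ Icc 0 L.TN :=
      ⟨mul_nonneg (Nat.cast_nonneg _) L.δ_pos.le,
        mul_le_mul_of_nonneg_right (Nat.cast_le.2 hlN) L.δ_pos.le⟩
    -- Both points lie in M, u_l as a value of Û, and both have M_0 equal to B(0,T_l)/B(0,T_N) = exp
    -- ∫_{T_l}^{T_N} f.
    refine hinj (hUM _ hlm) (hU₀.interpolates l hl hlN ▸ hmaps hlm) ?_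
    rw [hUE _ hlm, hB l hl hlN, hfB l hl hlN, hBN, ← Real.exp_sub,
      ← intervalIntegral.integral_add_adjacent_intervals (hint 0 h0m _ hlm) (hint _ hlm _ hTm)]
    congr 1
    ring
  · intro t ht
    rw [← Real.exp_eq_exp, ← L.M₀_eq_exp (hIM (hUM t ht)), hUE t ht]
  · intro V hV t ht
    refine hinj (hV.mapsTo ht) (hUM t ht) ?_
    rw [hUE t ht, L.M₀_eq_exp (hIM (hV.mapsTo ht)), hV.fits t ht]
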